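/- **Proposition 3.4.** Let $X$ be a second countable, locally compact Hausdorff space. Then $$\mathrm{dr}\,(\mathcal C_0(X)) = \dim X$$ (as elements of $\{-1,0,1,2,\dots\}\cup\{\infty\}$; in particular one side is finite if and only if the other is). Here the two sides are defined as follows. *Covering dimension.* A family $(U_\lambda)_{\lambda\in\Lambda}$ of subsets of $X$ has order not exceeding $n$ if $U_{\lambda_0}\cap\dots\cap U_{\lambda_{n+1}}=\emptyset$ for any $n+2$ distinct indices. $\dim X$ is the least integer $n\ge -1$ such that every finite open covering of $X$ has an open refinement (a covering of $X$ by open sets each of which is contained in a member of the given covering) of order not exceeding $n$; $\dim X=\infty$ if there is no such $n$. (Thus $\dim\emptyset=-1$.) *Decomposition rank.* Let $A$ be a separable $C^*$-algebra. A completely positive map $\varphi:F\to A$ from a finite-dimensional $C^*$-algebra $F$ is said to have strict order zero if $\varphi(e_0)\varphi(e_1)=0$ for any two orthogonal minimal projections $e_0,e_1\in F$. A completely positive map $\varphi:M_{r_1}(\mathbb C)\oplus\dots\oplus M_{r_s}(\mathbb C)\to A$ is $n$-decomposable if $\{1,\dots,s\}$ is a disjoint union of $n+1$ (possibly empty) sets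 $I_0,\dots,I_n$ such that for each $j$ the restriction of $\varphi$ to $\bigoplus_{i\in I_j}M_{r_i}(\mathbb C)$ has strict order zero. $\mathrm{dr}\,A$ is the least integer $n\ge -1$ such that for all $b_1,\dots,b_m\in A$ and $\varepsilon>0$ there are a finite direct sum $F$ of full matrix algebras over $\mathbb C$ (the empty sum $F=0$ being allowed) and completely positive contractive maps $\psi:A\to F$ and $\varphi:F\to A$ such that $\|\varphi(\psi(b_k))-b_k\|<\varepsilon$ for $k=1,\dots,m$ and $\varphi$ is $n$-decomposable; $\mathrm{dr}\,A=\infty$ if there is no such $n$. (Thus $\mathrm{dr}\,0=-1$.) -/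

import Mathlib

open scoped ComplexOrder ZeroAtInfty CStarAlgebra

universe u

/-! ### Dimension-like invariants

Both invariants below are of the form "the least integer `n ≥ -1` such that a condition holds".
The conditions are stated in terms of the natural number `m = n + 1`. -/

/-- The number `m - 1`, as an element of `{-1, 0, 1, 2, …, ∞}`; here `⊥` stands for `-1`. -/
def subOneDim : ℕ → WithBot ℕ∞
  | 0 => ⊥
  | n + 1 => ((n : ℕ∞) : WithBot ℕ∞)

/-- The least integer `n ≥ -1` such that `P (n + 1)` holds, with value `∞` if there is none. -/
noncomputable def leastDim (P : ℕ → Prop) : WithBot ℕ∞ :=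
  ⨅ (m : ℕ) (_ : P m), subOneDim m

/-! ### Covering dimension -/

/-- The order of the family `V` of subsets is less than `m`, i.e. does not exceed `n = m - 1`:
any `m + 1 = n + 2` members with distinct indices have empty intersection. -/
def FamilyOrderLT {X ι : Type*} (V : ι → Set X) (m : ℕ) : Prop :=
  ∀ s : Finset ι, s.card = m + 1 → ⋂ i ∈ s, V i = ∅

/-- The covering dimension of `X` is less than `m`, i.e. does not exceed `n = m - 1`: every finite
open covering of `X` has an open refinement (again a covering) of order not exceeding `n`. -/
def CoveringDimLT (X : Type u) [TopologicalSpace X] (m : ℕ) : Prop :=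
  ∀ (k : ℕ) (U : Fin k → Set X), (∀ i, IsOpen (U i)) → ⋃ i, U i = Set.univ →
    ∃ (ι : Type u) (V : ι → Set X),
      (∀ l, IsOpen (V l)) ∧ ⋃ l, V l = Set.univ ∧ (∀ l, ∃ i, V l ⊆ U i) ∧ FamilyOrderLT V m

/-- The covering dimension of a topological space: the least integer `n ≥ -1` such that every
finite open covering has an open refinement of order not exceeding `n` (and `∞` if there is none).
The empty space has dimension `-1 = ⊥`. -/
noncomputable def coveringDim (X : Type u) [TopologicalSpace X] : WithBot ℕ∞ :=
  leastDim (CoveringDimLT X)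

/-! ### Strict order and decomposability of completely positive maps -/

/-- A minimal projection: a nonzero projection with no nonzero projection strictly below it. -/
def IsMinimalProjection {F : Type*} [NonUnitalSemiring F] [Star F] (p : F) : Prop :=
  IsStarProjection p ∧ p ≠ 0 ∧ ∀ q : F, IsStarProjection q → q * p = q → q = 0 ∨ q = p

/-- The map `φ` has strict order at most `n`: among any `n + 2` pairwise orthogonal minimal
projections of `F` there are two (with different indices) that `φ` sends to orthogonal elements.
(For a completely positive `φ` these images are self-adjoint, so that orthogonality of `a` and `b`
means `a * b = 0`.) -/
def StrictOrderLE {F A : Type*} [NonUnitalSemiring F] [Star F] [Mul A] [Zero A]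
    (φ : F → A) (n : ℕ) : Prop :=
  ∀ e : Fin (n + 2) → F, (∀ i, IsMinimalProjection (e i)) → (∀ i j, i ≠ j → e i * e j = 0) →
    ∃ i j, i ≠ j ∧ φ (e i) * φ (e j) = 0

/-- The finite-dimensional C⋆-algebra `M_{r 0} ⊕ … ⊕ M_{r (s-1)}`. -/
abbrev MatSum {s : ℕ} (r : Fin s → ℕ) : Type :=
  ∀ i : Fin s, CStarMatrix (Fin (r i)) (Fin (r i)) ℂ

/-- The partial direct sum of the matrix algebras `M_{r i}` with `i ∈ I`. -/
abbrev PartialMatSum {s : ℕ} (r : Fin s → ℕ) (I : Set (Fin s)) : Type :=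
  ∀ i : I, CStarMatrix (Fin (r i)) (Fin (r i)) ℂ

open Classical in
/-- The inclusion of the partial direct sum over `I` into the whole direct sum (extension by
zero). -/
noncomputable def PartialMatSum.incl {s : ℕ} (r : Fin s → ℕ) (I : Set (Fin s))
    (x : PartialMatSum r I) : MatSum r :=
  fun i => if h : i ∈ I then x ⟨i, h⟩ else 0

/-- A map `φ` on `M_{r 0} ⊕ … ⊕ M_{r (s-1)}` is decomposable with `m` colours, i.e.
`n`-decomposable for `n = m - 1`: the index set is the disjoint union of `m = n + 1` (possibly
empty) subsets, such that the restriction of `φ` to each of the corresponding partial sums has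
strict order zero. -/
def IsDecomposable {A : Type*} [Mul A] [Zero A] {s : ℕ} {r : Fin s → ℕ}
    (φ : MatSum r → A) (m : ℕ) : Prop :=
  ∃ c : Fin s → Fin m, ∀ j : Fin m,
    StrictOrderLE (fun x => φ (PartialMatSum.incl r {i | c i = j} x)) 0

/-! ### Decomposition rank -/

/-- The decomposition rank of `A` is less than `m`, i.e. does not exceed `n = m - 1`: for every
finite subset `b` of `A` and every `ε > 0` there is a completely positive contractive approximation
`A → M_{r 0} ⊕ … ⊕ M_{r (s-1)} → A` of the identity on `b` within `ε` whose second map is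
`n`-decomposable. -/
def DecompositionRankLT (A : Type*) [NonUnitalCStarAlgebra A] [PartialOrder A] [StarOrderedRing A]
    (m : ℕ) : Prop :=
  ∀ (b : Finset A) (ε : ℝ), 0 < ε →
    ∃ (s : ℕ) (r : Fin s → ℕ) (ψ : A →CP MatSum r) (φ : MatSum r →CP A),
      (∀ i, 0 < r i) ∧ (∀ a, ‖ψ a‖ ≤ ‖a‖) ∧ (∀ x, ‖φ x‖ ≤ ‖x‖) ∧
      (∀ a ∈ b, ‖φ (ψ a) - a‖ < ε) ∧ IsDecomposable φ m

/-- The decomposition rank of a C⋆-algebra: the least integer `n ≥ -1` such that any finitely many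
elements can be approximated arbitrarily well by completely positive contractive approximations
with `n`-decomposable second map (and `∞` if there is none). The zero algebra has decomposition
rank `-1 = ⊥`. -/
noncomputable def decompositionRank (A : Type*) [NonUnitalCStarAlgebra A] [PartialOrder A]
    [StarOrderedRing A] : WithBot ℕ∞ :=
  leastDim (DecompositionRankLT A)

/-! ### The order of the C⋆-algebra `C₀(X, ℂ)` -/

section ZeroAtInftyOrder

variable {X : Type*} [TopologicalSpace X]

/-- The pointwise order on `C₀(X, ℂ)`. -/
noncomputable instance ZeroAtInftyContinuousMap.instPartialOrderComplex : PartialOrder C₀(X, ℂ) :=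
  PartialOrder.lift (fun f => (f : X → ℂ)) DFunLike.coe_injective

/-- With the pointwise order, the positive elements of `C₀(X, ℂ)` are exactly the `star s * s`. -/
instance ZeroAtInftyContinuousMap.instStarOrderedRingComplex : StarOrderedRing C₀(X, ℂ) := by
  refine StarOrderedRing.of_le_iff fun f g => ⟨fun h => ?_, ?_⟩
  · have h' : ∀ x, f x ≤ g x := h
    have hc : Continuous fun z : ℂ => ((Real.sqrt z.re : ℝ) : ℂ) := by fun_prop
    refine ⟨⟨⟨fun x => ((Real.sqrt ((g - f) x).re : ℝ) : ℂ),
      hc.comp (g - f).continuous⟩, ?_⟩, ?_⟩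
    · have := (hc.tendsto 0).comp (g - f).zero_at_infty'
      simpa [Function.comp_def] using this
    · ext x
      have hx := h' x
      rw [← sub_nonneg, Complex.nonneg_iff] at hx
      have e : g x - f x = (((g x - f x).re : ℝ) : ℂ) := by
        apply Complex.ext
        · simp
        · simpa using hx.2.symm
      change g x = f x + star ((Real.sqrt ((g x - f x)).re : ℝ) : ℂ) *
        ((Real.sqrt ((g x - f x)).re : ℝ) : ℂ)
      rw [Complex.star_def, Complex.conj_ofReal, ← Complex.ofReal_mul, Real.mul_self_sqrt hx.1,
        ← e]
      ring
  · rintro ⟨s, rfl⟩ x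
    change f x ≤ f x + star (s x) * s x
    exact le_add_of_nonneg_right (star_mul_self_nonneg _)

end ZeroAtInftyOrder

/-! For each `m = n + 1` the conditions defining the two invariants are equivalent, so the least
values agree. From dimension to rank: a partition of unity subordinate to a cover of order at most
`n` can be barycentrically subdivided, so that it splits into `m` colours with functions of equal
colour disjoint. Evaluating at points and recombining with these functions approximates the identity
of `C₀(X, ℂ)` through `ℂ ⊕ … ⊕ ℂ` (`CoveringDimLT.decompositionRankLT`). From rank to dimension:
over a point `x`, strict order zero forces every block whose unit is nonzero at `x` to have size
one, and leaves at most one such block per colour (`StrictOrderLE.size_le_one`,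
`StrictOrderLE.apply_single_one_mul_eq_zero`). Superlevel sets of the images of the block units
therefore have order at most `n`; they refine a cover over a compact set
(`DecompositionRankLT.exists_shrinking`), and `coveringDimLT_of_isCompact` globalises this. Second
countability enters through normality and `σ`-compactness. -/

/-! ### Covering dimension: shrinkings, gluing over compact sets, coloured partitions of unity. -/

section CoveringDimension

open Set Topology

theorem familyOrderLT_iff {X ι : Type*} {V : ι → Set X} {m : ℕ} :
    FamilyOrderLT V m ↔ ∀ (x : X) (s : Finset ι), s.card = m + 1 → ∃ i ∈ s, x ∉ V i := by
  unfold FamilyOrderLT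
  constructor
  · intro h x s hs
    by_contra! hx
    have : x ∈ ⋂ i ∈ s, V i := by simpa using hx
    simp [h s hs] at this
  · intro h s hs
    ext x
    obtain ⟨i, hi, hx⟩ := h x s hs
    simp only [mem_iInter, mem_empty_iff_false, iff_false, not_forall]
    exact ⟨i, hi, hx⟩

/-- Uniting the members of a family along a map of indices does not increase the order. -/
theorem FamilyOrderLT.iUnion_fiber {X ι κ : Type*} {V : ι → Set X} {m : ℕ}
    (h : FamilyOrderLT V m) (p : ι → κ) :
    FamilyOrderLT (fun k => ⋃ (i : ι) (_ : p i = k), V i) m := by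
  classical
  rw [familyOrderLT_iff] at h ⊢
  intro x s hs
  by_contra! hx
  simp only [mem_iUnion, exists_prop] at hx
  obtain ⟨k₀, hk₀⟩ : s.Nonempty := Finset.card_pos.1 (by omega)
  have : Nonempty ι := ⟨(hx k₀ hk₀).choose⟩
  choose! i hi hix using hx
  have hinj : Set.InjOn i s := fun a ha b hb hab => by
    rw [← hi a ha, ← hi b hb, hab]
  obtain ⟨j, hj, hjx⟩ := h x (s.image i) (by rw [Finset.card_image_of_injOn hinj, hs])
  obtain ⟨k, hk, rfl⟩ := Finset.mem_image.1 hj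
  exact hjx (hix k hk)

/-- A finite open covering of a space of covering dimension less than `m` has an open shrinking of
order less than `m`. -/
theorem CoveringDimLT.exists_shrinking {X : Type u} [TopologicalSpace X] {m : ℕ}
    (h : CoveringDimLT X m) {k : ℕ} {U : Fin k → Set X} (hU : ∀ i, IsOpen (U i))
    (hcov : ⋃ i, U i = univ) :
    ∃ V : Fin k → Set X, (∀ i, IsOpen (V i)) ∧ ⋃ i, V i = univ ∧ (∀ i, V i ⊆ U i) ∧
      FamilyOrderLT V m := by
  obtain ⟨ι, V, hV, hVcov, hVU, hord⟩ := h k U hU hcov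
  choose p hp using hVU
  refine ⟨fun k => ⋃ (i : ι) (_ : p i = k), V i, fun i => ?_, ?_, fun i => ?_,
    hord.iUnion_fiber p⟩
  · exact isOpen_iUnion fun l => isOpen_iUnion fun _ => hV l
  · refine eq_univ_of_forall fun x => ?_
    have hx : x ∈ ⋃ l, V l := hVcov ▸ mem_univ x
    obtain ⟨l, hl⟩ := mem_iUnion.1 hx
    exact mem_iUnion.2 ⟨p l, mem_iUnion₂.2 ⟨l, rfl, hl⟩⟩
  · refine iUnion₂_subset fun l hl => ?_
    rw [← hl]
    exact hp l

/-- The family `V` has order less than `m` at each point of `K`. -/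
def FamilyOrderLTOn {X ι : Type*} (V : ι → Set X) (m : ℕ) (K : Set X) : Prop :=
  ∀ x ∈ K, ∀ s : Finset ι, s.card = m + 1 → ∃ i ∈ s, x ∉ V i

/-- In a locally compact `σ`-compact space, it suffices to find open shrinkings of small order over
compact subsets: these can be glued along an exhaustion, since shrinking a covering near a compact
set need not change it where its order is already small. -/
theorem coveringDimLT_of_isCompact {X : Type u} [TopologicalSpace X] [T2Space X]
    [WeaklyLocallyCompactSpace X] [SigmaCompactSpace X] {m : ℕ}
    (h : ∀ K : Set X, IsCompact K → ∀ (k : ℕ) (U : Fin k → Set X), (∀ i, IsOpen (U i)) →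
      K ⊆ ⋃ i, U i → ∃ V : Fin k → Set X, (∀ i, IsOpen (V i)) ∧ (∀ i, V i ⊆ U i) ∧
        K ⊆ ⋃ i, V i ∧ FamilyOrderLTOn V m K) :
    CoveringDimLT X m := by
  intro k U₀ hU₀ hcov₀
  have step : ∀ (U : Fin k → Set X), (∀ i, IsOpen (U i)) → ⋃ i, U i = univ →
      ∀ G K : Set X, IsOpen G → IsCompact K → FamilyOrderLTOn U m G →
      ∃ W : Fin k → Set X, (∀ i, IsOpen (W i)) ∧ ⋃ i, W i = univ ∧ (∀ i, W i ⊆ U i) ∧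
        FamilyOrderLTOn W m K ∧ ∀ i, U i ∩ G ⊆ W i := by
    intro U hU hcov G K hG hK hord
    obtain ⟨V, hV, hVU, hVK, hVord⟩ := h K hK k U hU (by simp [hcov])
    have hWU : ∀ i, U i ∩ G ∪ V i ∪ U i \ K ⊆ U i := fun i =>
      union_subset (union_subset inter_subset_left (hVU i)) sdiff_subset
    -- On `G` the order is already small and only `W ⊆ U` matters; on `K` outside `G` the first and
    -- third pieces are absent, so the order is that of `V`. The piece `U i \ K` keeps the cover
    -- global.
    refine ⟨fun i => U i ∩ G ∪ V i ∪ U i \ K, fun i => ?_, ?_, hWU, ?_, fun i => ?_⟩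
    · exact (((hU i).inter hG).union (hV i)).union ((hU i).sdiff hK.isClosed)
    · refine eq_univ_of_forall fun x => ?_
      by_cases hx : x ∈ K
      · obtain ⟨i, hi⟩ := mem_iUnion.1 (hVK hx)
        exact mem_iUnion.2 ⟨i, Or.inl (Or.inr hi)⟩
      · have hx' : x ∈ ⋃ i, U i := hcov ▸ mem_univ x
        obtain ⟨i, hi⟩ := mem_iUnion.1 hx'
        exact mem_iUnion.2 ⟨i, Or.inr ⟨hi, hx⟩⟩
    · intro x hx s hs
      by_cases hxG : x ∈ G
      · obtain ⟨i, his, hi⟩ := hord x hxG s hs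
        exact ⟨i, his, fun hxi => hi (hWU i hxi)⟩
      · obtain ⟨i, his, hi⟩ := hVord x hx s hs
        refine ⟨i, his, ?_⟩
        rintro ((h1 | h1) | h1)
        · exact hxG h1.2
        · exact hi h1
        · exact h1.2 hx
    · exact fun x hx => Or.inl (Or.inl hx)
  let K : CompactExhaustion X := default
  let S (j : ℕ) : Type u := {U : Fin k → Set X // (∀ i, IsOpen (U i)) ∧ ⋃ i, U i = univ ∧
    (∀ i, U i ⊆ U₀ i) ∧ FamilyOrderLTOn U m (K j)}
  have base : Nonempty (S 0) := by
    obtain ⟨W, hW, hWc, hWU, hWo, -⟩ := step U₀ hU₀ hcov₀ ∅ (K 0) isOpen_empty (K.isCompact 0)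
      (fun x hx => hx.elim)
    exact ⟨W, hW, hWc, hWU, hWo⟩
  have next : ∀ (j : ℕ) (U : S j), ∃ W : S (j + 1), (∀ i, W.1 i ⊆ U.1 i) ∧
      ∀ i, U.1 i ∩ interior (K j) ⊆ W.1 i := by
    rintro j ⟨U, hU, hUc, hUU, hUo⟩
    obtain ⟨W, hW, hWc, hWU, hWo, hWi⟩ := step U hU hUc (interior (K j)) (K (j + 1))
      isOpen_interior (K.isCompact _) (fun x hx => hUo x (interior_subset hx))
    exact ⟨⟨W, hW, hWc, fun i => (hWU i).trans (hUU i), hWo⟩, hWU, hWi⟩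
  choose f hf hf' using next
  let T : ∀ j, S j := fun j => Nat.rec base.some f j
  have hT : ∀ j, T (j + 1) = f j (T j) := fun j => rfl
  have hanti : ∀ {a b : ℕ}, a ≤ b → ∀ i, (T b).1 i ⊆ (T a).1 i := by
    intro a b hab i
    induction b, hab using Nat.le_induction with
    | base => exact subset_rfl
    | succ b _ ih => rw [hT]; exact (hf b (T b) i).trans ih
  have hstab : ∀ {a b : ℕ}, a ≤ b → ∀ i, (T a).1 i ∩ interior (K a) ⊆ (T b).1 i := by
    intro a b hab i
    induction b, hab using Nat.le_induction with
    | base => exact inter_subset_left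
    | succ b hb ih =>
      rw [hT]
      exact fun x hx => hf' b (T b) i ⟨ih hx, interior_mono (K.subset hb) hx.2⟩
  have hint : ∀ x, ∃ j, x ∈ interior (K j) := fun x =>
    ⟨_, K.subset_interior_succ _ (K.mem_find x)⟩
  -- The covers decrease, but from stage `a` on they no longer change inside `interior (K a)`. A
  -- point of a limit set thus lies in the corresponding set at every stage, and the order at `x` is
  -- controlled by a single stage `j` with `x ∈ K j`.
  have hV : ∀ i x, (∃ j, x ∈ (T j).1 i ∩ interior (K j)) →
      ∀ j, x ∈ (T j).1 i := by
    rintro i x ⟨a, ha⟩ j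
    rcases le_total a j with haj | haj
    · exact hstab haj i ha
    · exact hanti haj i ha.1
  refine ⟨ULift (Fin k), fun i => ⋃ j, (T j).1 i.down ∩ interior (K j), fun i => ?_, ?_,
    fun i => ⟨i.down, ?_⟩, ?_⟩
  · exact isOpen_iUnion fun j => ((T j).2.1 _).inter isOpen_interior
  · refine eq_univ_of_forall fun x => ?_
    obtain ⟨j, hj⟩ := hint x
    have hx : x ∈ ⋃ i, (T j).1 i := by rw [(T j).2.2.1]; exact mem_univ x
    obtain ⟨i, hi⟩ := mem_iUnion.1 hx
    exact mem_iUnion.2 ⟨⟨i⟩, mem_iUnion.2 ⟨j, hi, hj⟩⟩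
  · exact iUnion_subset fun j => inter_subset_left.trans ((T j).2.2.2.1 _)
  · rw [familyOrderLT_iff]
    intro x s hs
    obtain ⟨j, hj⟩ := hint x
    obtain ⟨i, hi, hxi⟩ := (T j).2.2.2.2 x (interior_subset hj)
      (s.map Equiv.ulift.toEmbedding) (by simpa using hs)
    obtain ⟨l, hl, rfl⟩ := Finset.mem_map.1 hi
    refine ⟨l, hl, fun hx => hxi (hV _ x (mem_iUnion.1 hx) j)⟩

/-- In a normal space of covering dimension less than `m`, every finite open covering has a
subordinate finite partition of unity in `m` colours, such that functions of the same colour have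
disjoint supports. -/
theorem CoveringDimLT.exists_coloured_partitionOfUnity {X : Type u} [TopologicalSpace X]
    [NormalSpace X] {m : ℕ} (h : CoveringDimLT X m) {k : ℕ} {U : Fin k → Set X}
    (hU : ∀ i, IsOpen (U i)) (hcov : ⋃ i, U i = univ) :
    ∃ (ι : Type) (_ : Fintype ι) (g : ι → C(X, ℝ)) (c : ι → ℕ),
      (∀ a x, 0 ≤ g a x) ∧ (∀ x, ∑ a, g a x = 1) ∧
      (∀ a, ∃ i, ∀ x, g a x ≠ 0 → x ∈ U i) ∧ (∀ a x, g a x ≠ 0 → c a < m) ∧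
      ∀ a b x, a ≠ b → c a = c b → g a x * g b x = 0 := by
  classical
  obtain ⟨V, hVo, hVcov, hVU, hord⟩ := h.exists_shrinking hU hcov
  obtain ⟨f, hf⟩ := PartitionOfUnity.exists_isSubordinate_of_locallyFinite isClosed_univ V hVo
    (locallyFinite_of_finite V) hVcov.ge
  have hf0 : ∀ i x, 0 ≤ f i x := fun i x => f.nonneg i x
  have hfV : ∀ i x, f i x ≠ 0 → x ∈ V i := fun i x hx => hf i (subset_tsupport _ hx)
  -- Barycentric subdivision of the nerve: `H S` is positive exactly where the `f i` with `i ∈ S`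
  -- are positive and each exceeds every `f j` with `j ∉ S`. Two distinct sets of equal size each
  -- contain an index outside the other, which gives contradictory inequalities; so the size serves
  -- as colour.
  let H : {S : Finset (Fin k) // S.Nonempty} → C(X, ℝ) := fun S =>
    (∏ i ∈ S.1, f i) * ∏ i ∈ S.1, ∏ j ∈ S.1ᶜ, ((f i - f j) ⊔ 0)
  have Happ : ∀ S x, H S x = (∏ i ∈ S.1, f i x) * ∏ i ∈ S.1, ∏ j ∈ S.1ᶜ, max (f i x - f j x) 0 := by
    intro S x
    simp [H, ContinuousMap.prod_apply]
  have H0 : ∀ S x, 0 ≤ H S x := fun S x => by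
    rw [Happ]
    exact mul_nonneg (Finset.prod_nonneg fun i _ => hf0 i x) (Finset.prod_nonneg fun i _ =>
      Finset.prod_nonneg fun j _ => le_max_right _ _)
  have Hne : ∀ S x, H S x ≠ 0 → (∀ i ∈ S.1, f i x ≠ 0) ∧ ∀ i ∈ S.1, ∀ j ∉ S.1, f j x < f i x := by
    intro S x hx
    rw [Happ] at hx
    refine ⟨Finset.prod_ne_zero_iff.1 (left_ne_zero_of_mul hx), fun i hi j hj => ?_⟩
    have h1 := Finset.prod_ne_zero_iff.1
      (Finset.prod_ne_zero_iff.1 (right_ne_zero_of_mul hx) i hi) j (Finset.mem_compl.2 hj)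
    by_contra! hle
    exact h1 (max_eq_right (by linarith))
  have Hcard : ∀ S x, H S x ≠ 0 → S.1.card ≤ m := by
    intro S x hx
    by_contra! hlt
    obtain ⟨s, hsS, hs⟩ := Finset.exists_subset_card_eq (Nat.succ_le_of_lt hlt)
    obtain ⟨i, hi, hxi⟩ := familyOrderLT_iff.1 hord x s hs
    exact hxi (hfV i x ((Hne S x hx).1 i (hsS hi)))
  have Hpos : ∀ x, 0 < ∑ S, H S x := by
    intro x
    have hsum : ∑ i, f i x = 1 := by
      rw [← finsum_eq_sum_of_fintype]
      exact f.sum_eq_one (mem_univ x)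
    have hne : (Finset.univ : Finset (Fin k)).Nonempty := by
      by_contra hemp
      rw [Finset.not_nonempty_iff_eq_empty] at hemp
      simp [hemp] at hsum
    obtain ⟨i₀, -, hi₀⟩ := Finset.exists_max_image Finset.univ (fun i => f i x) hne
    have hi₀pos : 0 < f i₀ x := by
      by_contra! hle
      have : ∑ i, f i x ≤ 0 := Finset.sum_nonpos fun i hi => (hi₀ i hi).trans hle
      linarith
    -- The set of indices where the maximum at `x` is attained has `H S x > 0`.
    let S : {S : Finset (Fin k) // S.Nonempty} :=
      ⟨Finset.univ.filter fun i => f i x = f i₀ x, i₀, by simp⟩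
    refine Finset.sum_pos' (fun S _ => H0 S x) ⟨S, Finset.mem_univ _, ?_⟩
    rw [Happ]
    refine mul_pos (Finset.prod_pos fun i hi => ?_) (Finset.prod_pos fun i hi =>
      Finset.prod_pos fun j hj => ?_)
    · rw [(Finset.mem_filter.1 hi).2]
      exact hi₀pos
    · have hj' : f j x ≠ f i₀ x := fun he => Finset.mem_compl.1 hj (by simp [S, he])
      have := lt_of_le_of_ne (hi₀ j (Finset.mem_univ _)) hj'
      rw [← (Finset.mem_filter.1 hi).2] at this
      exact lt_max_of_lt_left (by linarith)
  let N : C(X, ℝ) := ⟨fun x => (∑ S, H S x)⁻¹,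
    (continuous_finsetSum _ fun S _ => (H S).continuous).inv₀ fun x => (Hpos x).ne'⟩
  have gne : ∀ S x, (H S * N) x ≠ 0 → H S x ≠ 0 := fun S x hx => left_ne_zero_of_mul hx
  -- Where `H S` is nonzero, `S` has between 1 and `m` elements; subtracting one yields colours
  -- below `m`.
  refine ⟨{S : Finset (Fin k) // S.Nonempty}, inferInstance, fun S => H S * N,
    fun S => S.1.card - 1, ?_, ?_, ?_, ?_, ?_⟩
  · exact fun S x => mul_nonneg (H0 S x) (inv_nonneg.2 (Hpos x).le)
  · intro x
    change ∑ S, H S x * (∑ S, H S x)⁻¹ = 1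
    rw [← Finset.sum_mul, mul_inv_cancel₀ (Hpos x).ne']
  · rintro S
    obtain ⟨i, hi⟩ := S.2
    exact ⟨i, fun x hx => hVU i (hfV i x ((Hne S x (gne S x hx)).1 i hi))⟩
  · intro S x hx
    have h1 := Hcard S x (gne S x hx)
    have h2 := S.2.card_pos
    change S.1.card - 1 < m
    omega
  · intro S S' x hSS' hc
    by_contra hx
    have hS := Hne S x (gne S x (left_ne_zero_of_mul hx))
    have hS' := Hne S' x (gne S' x (right_ne_zero_of_mul hx))
    have hcard : S.1.card = S'.1.card := by
      have h1 := S.2.card_pos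
      have h2 := S'.2.card_pos
      dsimp only at hc
      omega
    have hne : S.1 ≠ S'.1 := fun he => hSS' (Subtype.ext he)
    obtain ⟨i, hi, hi'⟩ : ∃ i ∈ S.1, i ∉ S'.1 := by
      by_contra! hsub
      exact hne (Finset.eq_of_subset_of_card_le hsub hcard.ge)
    obtain ⟨j, hj', hj⟩ : ∃ j ∈ S'.1, j ∉ S.1 := by
      by_contra! hsub
      exact hne (Finset.eq_of_subset_of_card_le hsub hcard.le).symm
    exact lt_asymm (hS.2 i hi j hj) (hS'.2 j hj' i hi')

end CoveringDimension

/-! ### From covering dimension to decomposition rank: approximation by point evaluations. -/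

section EvaluationApproximation

open Set Topology

theorem NonUnitalCStarAlgebra.nonneg_iff_exists_star_mul_self {A : Type*}
    [NonUnitalCStarAlgebra A] [PartialOrder A] [StarOrderedRing A] {a : A} :
    0 ≤ a ↔ ∃ b, a = star b * b :=
  CStarAlgebra.nonneg_iff_eq_star_mul_self

/-- A `⋆`-homomorphism to `ℂ` followed by multiplication with a positive element is completely
positive. -/
theorem CStarMatrix.map_smul_nonneg {A B : Type*} [NonUnitalCStarAlgebra A] [PartialOrder A]
    [StarOrderedRing A] [NonUnitalCStarAlgebra B] [PartialOrder B] [StarOrderedRing B]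
    (χ : A →⋆ₙₐ[ℂ] ℂ) {b : B} (hb : 0 ≤ b) {k : ℕ} {M : CStarMatrix (Fin k) (Fin k) A}
    (hM : 0 ≤ M) : 0 ≤ M.map fun a => χ a • b := by
  obtain ⟨q, rfl⟩ := NonUnitalCStarAlgebra.nonneg_iff_exists_star_mul_self.1 hb
  obtain ⟨N, rfl⟩ := NonUnitalCStarAlgebra.nonneg_iff_exists_star_mul_self.1 hM
  -- Since `χ` is multiplicative and `⋆`-preserving, a factor of the image is built from the factors
  -- of `M` and `b`.
  refine NonUnitalCStarAlgebra.nonneg_iff_exists_star_mul_self.2 ⟨N.map fun a => χ a • q, ?_⟩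
  ext i j
  simp only [CStarMatrix.map_apply, CStarMatrix.mul_apply, CStarMatrix.star_apply, map_sum,
    map_mul, map_star, Finset.sum_smul, star_smul, smul_mul_smul_comm]

/-- The unique entry of the `i`-th block of an element of `ℂ ⊕ … ⊕ ℂ`. -/
def MatSum.entryHom {s : ℕ} (i : Fin s) : MatSum (fun _ : Fin s => 1) →⋆ₙₐ[ℂ] ℂ where
  toFun y := y i 0 0
  map_smul' _ _ := rfl
  map_zero' := rfl
  map_add' _ _ := rfl
  map_mul' y z := by
    change (y i * z i) 0 0 = _
    simp [CStarMatrix.mul_apply]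
  map_star' _ := rfl

/-- The completely positive map `ℂ ⊕ … ⊕ ℂ → B` with prescribed positive values at the units. -/
noncomputable def MatSum.cpOfNonneg {B : Type*} [NonUnitalCStarAlgebra B] [PartialOrder B]
    [StarOrderedRing B] {s : ℕ} (b : Fin s → B) (hb : ∀ i, 0 ≤ b i) :
    MatSum (fun _ : Fin s => 1) →CP B where
  toFun y := ∑ i, MatSum.entryHom i y • b i
  map_add' y z := by simp only [map_add, add_smul, Finset.sum_add_distrib]
  map_smul' c y := by simp only [map_smul, smul_assoc, Finset.smul_sum, RingHom.id_apply]
  map_cstarMatrix_nonneg' k M hM := by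
    have : M.map (fun y => ∑ i, MatSum.entryHom i y • b i) =
        ∑ i, M.map fun y => MatSum.entryHom i y • b i := by
      ext p q
      induction (Finset.univ : Finset (Fin s)) using Finset.induction_on with
      | empty => simp [CStarMatrix.map_apply]
      | insert a t ha ih =>
        rw [Finset.sum_insert ha, CStarMatrix.add_apply, ← ih]
        simp [CStarMatrix.map_apply, Finset.sum_insert ha]
    change 0 ≤ M.map (fun y => ∑ i, MatSum.entryHom i y • b i)
    rw [this]
    exact Finset.sum_nonneg fun i _ => CStarMatrix.map_smul_nonneg _ (hb i) hM

theorem MatSum.cpOfNonneg_apply {B : Type*} [NonUnitalCStarAlgebra B] [PartialOrder B]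
    [StarOrderedRing B] {s : ℕ} (b : Fin s → B) (hb : ∀ i, 0 ≤ b i)
    (y : MatSum (fun _ : Fin s => 1)) :
    MatSum.cpOfNonneg b hb y = ∑ i, y i 0 0 • b i := rfl

/-- Evaluation of functions at finitely many points. -/
noncomputable def ZeroAtInftyContinuousMap.evalMatSum {X : Type*} [TopologicalSpace X] {s : ℕ}
    (p : Fin s → X) :
    C₀(X, ℂ) →⋆ₙₐ[ℂ] MatSum (fun _ : Fin s => 1) where
  toFun f i := CStarMatrix.ofMatrix fun _ _ => f (p i)
  map_smul' _ _ := rfl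
  map_zero' := rfl
  map_add' _ _ := rfl
  map_mul' f g := by
    ext i a b
    change f (p i) * g (p i) = ((CStarMatrix.ofMatrix fun _ _ => f (p i)) *
      (CStarMatrix.ofMatrix fun _ _ => g (p i)) : CStarMatrix (Fin 1) (Fin 1) ℂ) a b
    simp only [CStarMatrix.mul_apply, Fin.sum_univ_one]
    rfl
  map_star' _ := rfl

theorem ZeroAtInftyContinuousMap.norm_le_of_forall {X : Type*} [TopologicalSpace X]
    {f : C₀(X, ℂ)} {C : ℝ} (hC : 0 ≤ C) (h : ∀ x, ‖f x‖ ≤ C) : ‖f‖ ≤ C := by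
  rw [← ZeroAtInftyContinuousMap.norm_toBCF_eq_norm]
  exact (BoundedContinuousFunction.norm_le hC).2 h

theorem ZeroAtInftyContinuousMap.norm_apply_le {X : Type*} [TopologicalSpace X]
    (f : C₀(X, ℂ)) (x : X) : ‖f x‖ ≤ ‖f‖ := by
  rw [← ZeroAtInftyContinuousMap.norm_toBCF_eq_norm]
  exact f.toBCF.norm_coe_le_norm x

theorem ZeroAtInftyContinuousMap.sum_apply {X ι : Type*} [TopologicalSpace X]
    (t : Finset ι) (f : ι → C₀(X, ℂ)) (x : X) : (∑ i ∈ t, f i) x = ∑ i ∈ t, f i x := by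
  classical
  induction t using Finset.induction_on with
  | empty => simp
  | insert a t ha ih => simp [Finset.sum_insert ha, ih]

theorem CoveringDimLT.decompositionRankLT {X : Type u} [TopologicalSpace X] [NormalSpace X]
    {m : ℕ} (h : CoveringDimLT X m) : DecompositionRankLT C₀(X, ℂ) m := by
  classical
  intro b ε hε
  obtain ⟨r, hr, hrε⟩ : ∃ r : ℝ, 0 < r ∧ 3 * r < ε := ⟨ε / 4, by linarith, by linarith⟩
  -- All functions of `b` are treated at once: `F` has bounded range in a finite-dimensional space,
  -- so finitely many preimages of small balls cover `X`, each with oscillation below `r`.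
  let F : X → (b → ℂ) := fun x f => f.1 x
  have hFc : Continuous F := continuous_pi fun f => f.1.continuous
  have hF0 : Filter.Tendsto F (Filter.cocompact X) (𝓝 0) :=
    tendsto_pi_nhds.2 fun f => f.1.zero_at_infty'
  have hFb : TotallyBounded (range F) := by
    have : Bornology.IsBounded (range F) := by
      refine isBounded_iff_forall_norm_le.2 ⟨∑ f : b, ‖f.1‖, ?_⟩
      rintro _ ⟨x, rfl⟩
      refine (pi_norm_le_iff_of_nonneg (Finset.sum_nonneg fun f _ => norm_nonneg _)).2 fun f => ?_
      exact (f.1.norm_apply_le x).trans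
        (Finset.single_le_sum (f := fun f : b => ‖f.1‖) (fun f _ => norm_nonneg _)
          (Finset.mem_univ f))
    exact this.isCompact_closure.totallyBounded.subset subset_closure
  obtain ⟨t, ht, htF⟩ := Metric.totallyBounded_iff.1 hFb (r / 2) (by linarith)
  obtain ⟨k, z, -, rfl⟩ := ht.fin_param
  obtain ⟨ι, _, g, c, hg0, hg1, hgU, hgc, hdisj⟩ := h.exists_coloured_partitionOfUnity
    (U := fun i => F ⁻¹' Metric.ball (z i) (r / 2))
    (fun i => Metric.isOpen_ball.preimage hFc) (eq_univ_of_forall fun x => by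
      simpa using htF (mem_range_self x))
  have hnear : ∀ a x y, g a x ≠ 0 → g a y ≠ 0 → ‖F x - F y‖ < r := by
    intro a x y hx hy
    obtain ⟨i, hi⟩ := hgU a
    have h1 := hi x hx
    have h2 := hi y hy
    rw [mem_preimage, Metric.mem_ball] at h1 h2
    rw [← dist_eq_norm]
    linarith [dist_triangle_right (F x) (F y) (z i)]
  -- Only these functions are kept. By small oscillation each vanishes where `‖F‖ < r`, hence near
  -- infinity, so it lies in `C₀(X, ℂ)`. On the supports of the discarded ones `‖F‖ < 2 * r`, so
  -- dropping them costs little.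
  let T := {a : ι // ∃ x, g a x ≠ 0 ∧ 2 * r ≤ ‖F x‖}
  choose p hp hpF using fun a : T => a.2
  have hvan : ∀ a : T, Filter.Tendsto (fun x => ((g a.1 x : ℝ) : ℂ)) (Filter.cocompact X) (𝓝 0) := by
    intro a
    have hev : ∀ᶠ x in Filter.cocompact X, ‖F x‖ < r :=
      (hF0.norm).eventually_lt_const (by simpa using hr)
    refine tendsto_const_nhds.congr' (hev.mono fun x hx => ?_)
    by_contra hne
    have hgx : g a.1 x ≠ 0 := fun h0 => hne (by simp [h0])
    have h1 := hnear a.1 (p a) x (hp a) hgx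
    have h2 := hpF a
    have h3 := norm_sub_norm_le (F (p a)) (F x)
    linarith
  let G : T → C₀(X, ℂ) := fun a =>
    ⟨⟨fun x => ((g a.1 x : ℝ) : ℂ), Complex.continuous_ofReal.comp (g a.1).continuous⟩, hvan a⟩
  have hG : ∀ a x, G a x = ((g a.1 x : ℝ) : ℂ) := fun a x => rfl
  have hGn : ∀ a x, ‖G a x‖ = g a.1 x := fun a x => by
    rw [hG, Complex.norm_real, Real.norm_of_nonneg (hg0 _ _)]
  have hG0 : ∀ a, 0 ≤ G a := fun a x => by
    change (0 : ℂ) ≤ ((g a.1 x : ℝ) : ℂ)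
    exact_mod_cast hg0 _ _
  have hGsum : ∀ x, ∑ a : T, g a.1 x ≤ 1 := by
    intro x
    rw [← hg1 x, ← Fintype.sum_subtype_add_sum_subtype (fun a => ∃ x, g a x ≠ 0 ∧ 2 * r ≤ ‖F x‖)]
    exact le_add_of_nonneg_right (Finset.sum_nonneg fun a _ => hg0 _ _)
  let e : Fin (Fintype.card T) ≃ T := (Fintype.equivFin T).symm
  let ψ : C₀(X, ℂ) →⋆ₙₐ[ℂ] MatSum (fun _ : Fin (Fintype.card T) => 1) :=
    ZeroAtInftyContinuousMap.evalMatSum fun i => p (e i)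
  refine ⟨Fintype.card T, fun _ => 1, (ψ : C₀(X, ℂ) →CP MatSum (fun _ : Fin (Fintype.card T) => 1)),
    MatSum.cpOfNonneg (fun i => G (e i)) fun i => hG0 _, fun _ => one_pos, ?_, ?_, ?_, ?_⟩
  · intro a
    exact NonUnitalStarAlgHom.norm_apply_le ψ a
  · intro y
    refine ZeroAtInftyContinuousMap.norm_le_of_forall (norm_nonneg _) fun x => ?_
    rw [MatSum.cpOfNonneg_apply, ZeroAtInftyContinuousMap.sum_apply]
    calc ‖∑ i, (y i 0 0 • G (e i)) x‖ ≤ ∑ i, ‖y‖ * g (e i).1 x := by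
          refine norm_sum_le_of_le _ fun i _ => ?_
          rw [ZeroAtInftyContinuousMap.smul_apply, smul_eq_mul, norm_mul, hGn]
          exact mul_le_mul_of_nonneg_right
            (CStarMatrix.norm_entry_le_norm.trans (norm_le_pi_norm y i)) (hg0 _ _)
      _ = ‖y‖ * ∑ a : T, g a.1 x := by
          rw [← Finset.mul_sum, Equiv.sum_comp e fun a => g a.1 x]
      _ ≤ ‖y‖ := mul_le_of_le_one_right (norm_nonneg _) (hGsum x)
  · intro f hf
    refine lt_of_le_of_lt (ZeroAtInftyContinuousMap.norm_le_of_forall (by positivity) fun x => ?_) hrε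
    have happ : (MatSum.cpOfNonneg (fun i => G (e i)) fun i => hG0 _ :
        MatSum (fun _ : Fin (Fintype.card T) => 1) →CP C₀(X, ℂ)) (ψ f) x =
        ∑ a : T, f (p a) * g a.1 x := by
      rw [MatSum.cpOfNonneg_apply, ZeroAtInftyContinuousMap.sum_apply,
        ← Equiv.sum_comp e fun a : T => f (p a) * (g a.1 x : ℂ)]
      rfl
    have hcoord : ∀ v : b → ℂ, ‖v ⟨f, hf⟩‖ ≤ ‖v‖ := fun v => norm_le_pi_norm v _
    let q : ι → ℂ := fun a => if ha : ∃ x, g a x ≠ 0 ∧ 2 * r ≤ ‖F x‖ then f (p ⟨a, ha⟩) else 0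
    have hq : ∑ a : T, f (p a) * g a.1 x = ∑ a, q a * g a x := by
      rw [← Fintype.sum_subtype_add_sum_subtype (fun a => ∃ x, g a x ≠ 0 ∧ 2 * r ≤ ‖F x‖),
        Finset.sum_eq_zero (s := (Finset.univ : Finset {a // ¬ _})) fun a _ => by
          simp only [q, dif_neg a.2, zero_mul], add_zero]
      exact Finset.sum_congr rfl fun a _ => by simp only [q, dif_pos a.2]; rfl
    have hone : f x = ∑ a, f x * g a x := by
      rw [← Finset.mul_sum, ← Complex.ofReal_sum, hg1]
      simp
    rw [ZeroAtInftyContinuousMap.sub_apply]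
    refine (congrArg norm (congrArg₂ (· - ·) (happ.trans hq) hone)).trans_le ?_
    rw [← Finset.sum_sub_distrib]
    -- Kept indices contribute oscillation below `r`, discarded ones a value below `2 * r`; `3 * r`
    -- bounds both.
    calc ‖∑ a, (q a * g a x - f x * g a x)‖ ≤ ∑ a, 3 * r * g a x := by
          refine norm_sum_le_of_le _ fun a _ => ?_
          rw [← sub_mul, norm_mul, Complex.norm_real, Real.norm_of_nonneg (hg0 _ _)]
          by_cases hax : g a x = 0
          · simp [hax]
          refine mul_le_mul_of_nonneg_right ?_ (hg0 _ _)
          by_cases ha : ∃ x, g a x ≠ 0 ∧ 2 * r ≤ ‖F x‖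
          · simp only [q, dif_pos ha]
            have := hnear a _ x (hp ⟨a, ha⟩) hax
            exact (hcoord (F (p ⟨a, ha⟩) - F x)).trans (by linarith)
          · simp only [q, dif_neg ha, zero_sub, norm_neg]
            push Not at ha
            exact (hcoord (F x)).trans (by linarith [ha x hax])
      _ = 3 * r := by rw [← Finset.mul_sum, hg1, mul_one]
  · have hcm : ∀ a : T, c a.1 < m := fun a => hgc a.1 (p a) (hp a)
    refine ⟨fun i => ⟨c (e i).1, hcm _⟩, fun j e' _ hort => ⟨0, 1, by decide, ?_⟩⟩
    ext x
    rw [ZeroAtInftyContinuousMap.mul_apply]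
    simp only [MatSum.cpOfNonneg_apply, ZeroAtInftyContinuousMap.sum_apply,
      ZeroAtInftyContinuousMap.smul_apply, smul_eq_mul, ZeroAtInftyContinuousMap.zero_apply]
    rw [Finset.sum_mul_sum]
    refine Finset.sum_eq_zero fun i _ => Finset.sum_eq_zero fun i' _ => ?_
    by_cases hi : (⟨c (e i).1, hcm _⟩ : Fin m) = j
    swap
    · simp [PartialMatSum.incl, hi]
    by_cases hi' : (⟨c (e i').1, hcm _⟩ : Fin m) = j
    swap
    · simp [PartialMatSum.incl, hi']
    -- Within one block, which is `ℂ`, orthogonality kills the product of entries; for different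
    -- blocks of one colour the functions are disjoint.
    by_cases hii : i = i'
    · subst hii
      have h0 : (e' 0 * e' 1) ⟨i, hi⟩ 0 0 = 0 := by
        rw [hort 0 1 (by decide)]; rfl
      have h1 : e' 0 ⟨i, hi⟩ 0 0 * e' 1 ⟨i, hi⟩ 0 0 = 0 := by
        rw [Pi.mul_apply, CStarMatrix.mul_apply] at h0
        simpa using h0
      simp only [PartialMatSum.incl, mem_ofPred_eq, hi, dif_pos]
      rw [mul_mul_mul_comm, h1, zero_mul]
    · have hne : (e i).1 ≠ (e i').1 := fun hh => hii (e.injective (Subtype.ext hh))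
      have h0 := hdisj (e i).1 (e i').1 x hne (congrArg Fin.val (hi.trans hi'.symm))
      rw [mul_mul_mul_comm, hG, hG, ← Complex.ofReal_mul, h0, Complex.ofReal_zero, mul_zero]

end EvaluationApproximation

/-! ### Rank-one projections and functionals on matrix algebras. -/

section MinimalProjections

/-- The self-adjoint matrix `v vᵀ` of rank at most one given by a real vector `v`. -/
def CStarMatrix.realRankOne {n : Type*} (v : n → ℝ) : CStarMatrix n n ℂ :=
  CStarMatrix.ofMatrix fun i j => ((v i * v j : ℝ) : ℂ)

theorem CStarMatrix.realRankOne_apply {n : Type*} (v : n → ℝ) (i j : n) :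
    CStarMatrix.realRankOne v i j = ((v i * v j : ℝ) : ℂ) := rfl

theorem CStarMatrix.realRankOne_mul {n : Type*} [Fintype n] (v w : n → ℝ) (h : ∑ i, v i * w i = 0) :
    CStarMatrix.realRankOne v * CStarMatrix.realRankOne w = 0 := by
  ext i j
  rw [CStarMatrix.mul_apply, CStarMatrix.zero_apply]
  calc ∑ k, realRankOne v i k * realRankOne w k j
      = ((v i * w j * ∑ k, v k * w k : ℝ) : ℂ) := by
        simp only [realRankOne_apply, Finset.mul_sum, Complex.ofReal_sum]
        exact Finset.sum_congr rfl fun k _ => by push_cast; ring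
    _ = 0 := by rw [h]; simp

theorem CStarMatrix.realRankOne_mul_mul_realRankOne {n : Type*} [Fintype n] (v : n → ℝ)
    (q : CStarMatrix n n ℂ) :
    CStarMatrix.realRankOne v * q * CStarMatrix.realRankOne v =
      (∑ l, (∑ k, (v k : ℂ) * q k l) * v l) • CStarMatrix.realRankOne v := by
  ext i j
  rw [CStarMatrix.mul_apply, CStarMatrix.smul_apply, smul_eq_mul, Finset.sum_mul]
  refine Finset.sum_congr rfl fun l _ => ?_
  rw [CStarMatrix.mul_apply, Finset.sum_mul, Finset.sum_mul, Finset.sum_mul]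
  refine Finset.sum_congr rfl fun k _ => ?_
  simp only [realRankOne_apply]
  push_cast
  ring

theorem CStarMatrix.isMinimalProjection_realRankOne {n : Type*} [Fintype n] {v : n → ℝ}
    (hv : ∑ i, v i * v i = 1) : IsMinimalProjection (CStarMatrix.realRankOne v) := by
  have hne : realRankOne v ≠ 0 := by
    intro h0
    have : ∀ i, v i * v i = 0 := fun i => by
      have := congrFun (congrFun h0 i) i
      change realRankOne v i i = 0 at this
      rw [realRankOne_apply] at this
      exact_mod_cast this
    simp [this] at hv
  have hstar : star (realRankOne v) = realRankOne v := by
    ext i j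
    rw [CStarMatrix.star_apply, realRankOne_apply, realRankOne_apply, Complex.star_def,
      Complex.conj_ofReal, mul_comm]
  have hidem : realRankOne v * realRankOne v = realRankOne v := by
    ext i j
    rw [CStarMatrix.mul_apply]
    calc ∑ k, realRankOne v i k * realRankOne v k j
        = ((v i * v j * ∑ k, v k * v k : ℝ) : ℂ) := by
          simp only [realRankOne_apply, Finset.mul_sum, Complex.ofReal_sum]
          exact Finset.sum_congr rfl fun k _ => by push_cast; ring
      _ = _ := by rw [hv, mul_one, realRankOne_apply]
  refine ⟨⟨hidem, hstar⟩, hne, fun q hq hqp => ?_⟩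
  -- A projection `q` below `p` equals `p * q * p`, a scalar multiple `μ` of `p`; idempotency leaves
  -- `μ = 0` or `μ = 1`.
  have hpq : realRankOne v * q = q := by
    have := congrArg star hqp
    rwa [star_mul, hstar, hq.isSelfAdjoint.star_eq] at this
  have hq' := realRankOne_mul_mul_realRankOne v q
  rw [hpq, hqp] at hq'
  set μ : ℂ := ∑ l, (∑ k, (v k : ℂ) * q k l) * v l
  have hsq : (μ * μ) • realRankOne v = μ • realRankOne v := by
    have h1 := hq.isIdempotentElem.eq
    rw [hq'] at h1
    simpa only [smul_mul_smul_comm, hidem] using h1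
  have hμ : μ * μ - μ = 0 := by
    rw [← sub_eq_zero, ← sub_smul] at hsq
    exact (smul_eq_zero.1 hsq).resolve_right hne
  rcases mul_eq_zero.1 (show μ * (μ - 1) = 0 by linear_combination hμ) with h | h
  · left; rw [hq', h, zero_smul]
  · right; rw [hq', sub_eq_zero.1 h, one_smul]

theorem CStarMatrix.sum_realRankOne_single (n : Type*) [Fintype n] [DecidableEq n] :
    ∑ a : n, CStarMatrix.realRankOne (Pi.single a 1) = 1 := by
  have hsum : ∀ (t : Finset n) (i j : n), (∑ a ∈ t, realRankOne (Pi.single a 1)) i j =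
      ∑ a ∈ t, realRankOne (Pi.single a 1) i j := by
    intro t i j
    induction t using Finset.induction_on with
    | empty => rfl
    | insert a t ha ih => rw [Finset.sum_insert ha, CStarMatrix.add_apply, ih, Finset.sum_insert ha]
  ext i j
  rw [hsum, CStarMatrix.one_apply]
  simp only [realRankOne_apply]
  rw [Finset.sum_eq_single i (fun b _ hb => by simp [Pi.single_apply, hb.symm]) (by simp)]
  by_cases hij : i = j <;> simp [hij, eq_comm]

theorem CStarMatrix.isMinimalProjection_realRankOne_single {n : Type*} [Fintype n] [DecidableEq n]
    (a : n) : IsMinimalProjection (CStarMatrix.realRankOne (Pi.single a 1 : n → ℝ)) :=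
  CStarMatrix.isMinimalProjection_realRankOne (by simp [Pi.single_apply])

theorem IsMinimalProjection.single {ι : Type*} [DecidableEq ι] {A : ι → Type*}
    [∀ i, NonUnitalSemiring (A i)] [∀ i, StarRing (A i)] {i : ι} {p : A i}
    (hp : IsMinimalProjection p) : IsMinimalProjection (Pi.single i p : ∀ i, A i) := by
  obtain ⟨⟨hp1, hp2⟩, hp0, hmin⟩ := hp
  refine ⟨⟨?_, ?_⟩, fun h => hp0 (by simpa using congrFun h i), fun q hq hqp => ?_⟩
  · change Pi.single i p * Pi.single i p = Pi.single i p
    rw [← Pi.single_mul, hp1.eq]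
  · change star (Pi.single i p) = Pi.single i p
    rw [← Pi.single_star, hp2.star_eq]
  · have hq0 : q = Pi.single i (q i) := by
      ext j
      by_cases hj : j = i
      · subst hj; simp
      · rw [← hqp, Pi.mul_apply]
        simp [hj]
    have hqi : IsStarProjection (q i) :=
      ⟨congrFun hq.isIdempotentElem.eq i, congrFun hq.isSelfAdjoint.star_eq i⟩
    have hqpi : q i * p = q i := by
      have := congrFun hqp i
      rwa [Pi.mul_apply, Pi.single_eq_same] at this
    rcases hmin (q i) hqi hqpi with h | h
    · left; rw [hq0, h, Pi.single_zero]
    · right; rw [hq0, h]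

/-- A linear functional on a matrix algebra of size at least two with `τ p * τ q = 0` for orthogonal
minimal projections `p`, `q` vanishes at the unit. -/
theorem CStarMatrix.map_one_eq_zero_of_orthogonal {n : Type*} [Fintype n] [DecidableEq n]
    [Nontrivial n] (τ : CStarMatrix n n ℂ →ₗ[ℂ] ℂ)
    (h : ∀ p q, IsMinimalProjection p → IsMinimalProjection q → p * q = 0 → q * p = 0 →
      τ p * τ q = 0) : τ 1 = 0 := by
  have key : ∀ a : n, τ (realRankOne (Pi.single a 1)) = 0 := by
    intro a
    obtain ⟨b, hba⟩ := exists_ne a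
    let v : ℝ → ℝ → n → ℝ := fun c s => c • Pi.single a 1 + s • Pi.single b 1
    have hdot : ∀ c s c' s', ∑ i, v c s i * v c' s' i = c * c' + s * s' := by
      intro c s c' s'
      have hpt : ∀ i, v c s i * v c' s' i =
          (if i = a then c * c' else 0) + if i = b then s * s' else 0 := by
        intro i
        by_cases hia : i = a
        · subst hia; simp [v, hba.symm]
        · by_cases hib : i = b
          · subst hib; simp [v, hia]
          · simp [v, hia, hib]
      simp [hpt, Finset.sum_add_distrib]
    let P := realRankOne (Pi.single a 1 : n → ℝ)
    let Q := realRankOne (Pi.single b 1 : n → ℝ)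
    let R := realRankOne (v 1 1) - P - Q
    have hexp : ∀ c s : ℝ, realRankOne (v c s) =
        ((c * c : ℝ) : ℂ) • P + ((s * s : ℝ) : ℂ) • Q + ((c * s : ℝ) : ℂ) • R := by
      intro c s
      ext i j
      simp only [P, Q, R, CStarMatrix.add_apply, CStarMatrix.smul_apply, CStarMatrix.sub_apply,
        realRankOne_apply, v, smul_eq_mul, Pi.add_apply, Pi.smul_apply]
      push_cast
      ring
    have hτ : ∀ c s : ℝ, τ (realRankOne (v c s)) =
        (c * c : ℂ) * τ P + (s * s : ℂ) * τ Q + (c * s : ℂ) * τ R := by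
      intro c s
      simp [hexp]
    -- The hypothesis is applied to the orthonormal pair `(c, s)`, `(-s, c)` in the plane of the
    -- coordinates `a` and `b`.
    have hprod : ∀ c s : ℝ, c * c + s * s = 1 →
        ((c * c : ℂ) * τ P + (s * s : ℂ) * τ Q + (c * s : ℂ) * τ R) *
          ((s * s : ℂ) * τ P + (c * c : ℂ) * τ Q - (c * s : ℂ) * τ R) = 0 := by
      intro c s hcs
      have := h (realRankOne (v c s)) (realRankOne (v (-s) c))
        (isMinimalProjection_realRankOne (by rw [hdot, hcs]))
        (isMinimalProjection_realRankOne (by rw [hdot]; linarith))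
        (realRankOne_mul _ _ (by rw [hdot]; ring)) (realRankOne_mul _ _ (by rw [hdot]; ring))
      rw [hτ, hτ] at this
      push_cast at this
      linear_combination this
    -- Three rational points of the circle suffice. The first gives `t = 0` or `w = 0`. If `w = 0`
    -- and `t ≠ 0`, the second forces `z / t` to be `-3/4` or `4/3`, the third `-5/12` or `12/5`,
    -- which is impossible.
    have h0 := hprod 1 0 (by norm_num)
    have h1 := hprod (3 / 5) (4 / 5) (by norm_num)
    have h2 := hprod (5 / 13) (12 / 13) (by norm_num)
    push_cast at h0 h1 h2
    change τ P = 0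
    generalize τ P = t at *
    generalize τ Q = w at *
    generalize τ R = z at *
    rcases mul_eq_zero.1 (show t * w = 0 by linear_combination h0) with h0 | h0
    · exact h0
    subst h0
    rcases mul_eq_zero.1 h1 with h1 | h1 <;> rcases mul_eq_zero.1 h2 with h2 | h2
    · linear_combination (125 / 20) * h1 - (169 / 20) * h2
    · linear_combination (125 / 189) * h1 + (169 / 189) * h2
    · linear_combination (125 / 105) * h1 + (169 / 105) * h2
    · linear_combination -(125 / 64) * h1 + (169 / 64) * h2
  rw [← sum_realRankOne_single n, map_sum]
  exact Finset.sum_eq_zero fun a _ => key a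

end MinimalProjections

/-! ### Strict order zero maps into `C₀(X, ℂ)`, block by block and pointwise. -/

section Blocks

open Set Topology

theorem PartialMatSum.incl_single {s : ℕ} {r : Fin s → ℕ} {I : Set (Fin s)} [DecidableEq I]
    {i : Fin s} (hi : i ∈ I) (p : CStarMatrix (Fin (r i)) (Fin (r i)) ℂ) :
    PartialMatSum.incl r I (Pi.single ⟨i, hi⟩ p) = Pi.single i p := by
  ext1 j
  by_cases hj : j = i
  · subst hj
    simp [PartialMatSum.incl, hi]
  · rw [Pi.single_eq_of_ne hj]
    by_cases hjI : j ∈ I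
    · have : (⟨j, hjI⟩ : I) ≠ ⟨i, hi⟩ := fun hh => hj (congrArg Subtype.val hh)
      simp [PartialMatSum.incl, hjI, this]
    · simp [PartialMatSum.incl, hjI]

theorem CStarAlgebra.le_norm_smul_one {A : Type*} [CStarAlgebra A] [PartialOrder A]
    [StarOrderedRing A] {y : A} (hy : 0 ≤ y) : y ≤ (‖y‖ : ℂ) • 1 := by
  have := (IsSelfAdjoint.of_nonneg hy).le_algebraMap_norm_self
  rw [Algebra.algebraMap_eq_smul_one] at this
  exact_mod_cast this

variable {X : Type*} [TopologicalSpace X] {s : ℕ} {r : Fin s → ℕ}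

theorem CompletelyPositiveMap.apply_nonneg (φ : MatSum r →CP C₀(X, ℂ)) {y : MatSum r} (hy : 0 ≤ y)
    (x : X) : 0 ≤ φ y x := by
  have h : 0 ≤ φ y := map_nonneg φ hy
  exact h x

theorem CompletelyPositiveMap.apply_eq_sum_single (φ : MatSum r →CP C₀(X, ℂ)) (y : MatSum r)
    (x : X) : φ y x = ∑ i, φ (Pi.single i (y i)) x := by
  rw [← ZeroAtInftyContinuousMap.sum_apply, ← map_sum, Finset.univ_sum_single]

theorem MatSum.single_nonneg {i : Fin s} {y : CStarMatrix (Fin (r i)) (Fin (r i)) ℂ} (hy : 0 ≤ y) :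
    0 ≤ (Pi.single i y : MatSum r) :=
  Pi.single_nonneg.2 hy

/-- A positive functional vanishing at the unit vanishes on positive elements, because `0 ≤ y ≤ ‖y‖
• 1`. -/
theorem CompletelyPositiveMap.apply_single_eq_zero (φ : MatSum r →CP C₀(X, ℂ)) {i : Fin s} {x : X}
    (h : φ (Pi.single i 1) x = 0) {y : CStarMatrix (Fin (r i)) (Fin (r i)) ℂ} (hy : 0 ≤ y) :
    φ (Pi.single i y) x = 0 := by
  refine le_antisymm ?_ (φ.apply_nonneg (MatSum.single_nonneg hy) x)
  have h1 := φ.apply_nonneg (MatSum.single_nonneg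
    (sub_nonneg.2 (CStarAlgebra.le_norm_smul_one hy))) x
  rw [Pi.single_sub, Pi.single_smul, map_sub, map_smul, ZeroAtInftyContinuousMap.sub_apply,
    ZeroAtInftyContinuousMap.smul_apply, h, smul_zero, zero_sub] at h1
  exact neg_nonneg.1 h1

variable {φ : MatSum r →CP C₀(X, ℂ)}

theorem StrictOrderLE.apply_mul_apply_eq_zero {I : Set (Fin s)}
    (h : StrictOrderLE (fun x => φ (PartialMatSum.incl r I x)) 0) {p q : PartialMatSum r I}
    (hp : IsMinimalProjection p) (hq : IsMinimalProjection q) (hpq : p * q = 0) (hqp : q * p = 0)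
    (x : X) : φ (PartialMatSum.incl r I p) x * φ (PartialMatSum.incl r I q) x = 0 := by
  obtain ⟨i, j, hij, h0⟩ := h ![p, q] (by simp [Fin.forall_fin_two, hp, hq])
    (by simp [Fin.forall_fin_two, hpq, hqp])
  have h0x := congrArg (fun f : C₀(X, ℂ) => f x) h0
  simp only [ZeroAtInftyContinuousMap.mul_apply, ZeroAtInftyContinuousMap.zero_apply] at h0x
  fin_cases i <;> fin_cases j <;> simp_all [mul_comm]

/-- Evaluation at `x` turns `φ` on the block into a functional that kills one of any two orthogonal
minimal projections; on a block of size at least two this forces the value zero at the unit. -/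
theorem StrictOrderLE.size_le_one {I : Set (Fin s)}
    (h : StrictOrderLE (fun x => φ (PartialMatSum.incl r I x)) 0) {i : Fin s} (hi : i ∈ I) {x : X}
    (hx : φ (Pi.single i 1) x ≠ 0) : r i ≤ 1 := by
  classical
  by_contra! hr
  have : Nontrivial (Fin (r i)) := Fin.nontrivial_iff_two_le.2 hr
  let τ : CStarMatrix (Fin (r i)) (Fin (r i)) ℂ →ₗ[ℂ] ℂ :=
    { toFun := fun y => φ (Pi.single i y) x
      map_add' := fun y z => by rw [Pi.single_add, map_add, ZeroAtInftyContinuousMap.add_apply]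
      map_smul' := fun c y => by
        rw [Pi.single_smul, map_smul, ZeroAtInftyContinuousMap.smul_apply, RingHom.id_apply] }
  refine hx (CStarMatrix.map_one_eq_zero_of_orthogonal τ fun p q hp hq hpq hqp => ?_)
  change φ (Pi.single i p) x * φ (Pi.single i q) x = 0
  rw [← PartialMatSum.incl_single hi, ← PartialMatSum.incl_single hi]
  exact h.apply_mul_apply_eq_zero hp.single hq.single (by rw [← Pi.single_mul, hpq, Pi.single_zero])
    (by rw [← Pi.single_mul, hqp, Pi.single_zero]) x

/-- Each block unit is a sum of minimal projections, and those of different blocks are orthogonal.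
-/
theorem StrictOrderLE.apply_single_one_mul_eq_zero {I : Set (Fin s)}
    (h : StrictOrderLE (fun x => φ (PartialMatSum.incl r I x)) 0) {i j : Fin s} (hi : i ∈ I)
    (hj : j ∈ I) (hij : i ≠ j) (x : X) : φ (Pi.single i 1) x * φ (Pi.single j 1) x = 0 := by
  classical
  have hexp : ∀ k : Fin s, φ (Pi.single k 1) x =
      ∑ a, φ (Pi.single k (CStarMatrix.realRankOne (Pi.single a 1))) x := by
    intro k
    rw [← ZeroAtInftyContinuousMap.sum_apply, ← map_sum, ← CStarMatrix.sum_realRankOne_single]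
    congr 2
    exact map_sum (AddMonoidHom.single (fun i => CStarMatrix (Fin (r i)) (Fin (r i)) ℂ) k) _ _
  rw [hexp, hexp, Finset.sum_mul_sum]
  refine Finset.sum_eq_zero fun a _ => Finset.sum_eq_zero fun b _ => ?_
  have hort : ∀ (i j : I) (p : CStarMatrix (Fin (r i)) (Fin (r i)) ℂ)
      (q : CStarMatrix (Fin (r j)) (Fin (r j)) ℂ), i ≠ j →
      (Pi.single i p * Pi.single j q : PartialMatSum r I) = 0 := by
    intro i j p q hij
    ext1 k
    by_cases hk : k = i
    · subst hk; simp [hij]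
    · simp [hk]
  have hij' : (⟨i, hi⟩ : I) ≠ ⟨j, hj⟩ := fun hh => hij (congrArg Subtype.val hh)
  rw [← PartialMatSum.incl_single hi, ← PartialMatSum.incl_single hj]
  exact h.apply_mul_apply_eq_zero (CStarMatrix.isMinimalProjection_realRankOne_single a).single
    (CStarMatrix.isMinimalProjection_realRankOne_single b).single (hort _ _ _ _ hij')
    (hort _ _ _ _ hij'.symm) x

end Blocks

/-! ### From decomposition rank to covering dimension. -/

section DimensionOfSpectrum

open Set Topology

theorem CStarMatrix.eq_smul_one_of_le_one {r : ℕ} (hr : r ≤ 1) (y : CStarMatrix (Fin r) (Fin r) ℂ) :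
    y = (∑ a, y a a) • 1 := by
  have : Subsingleton (Fin r) := Fin.subsingleton_iff_le_one.2 hr
  ext a b
  obtain rfl := Subsingleton.elim a b
  rw [CStarMatrix.smul_apply, CStarMatrix.one_apply_eq, smul_eq_mul, mul_one,
    Fintype.sum_subsingleton _ a]

/-- A partition of unity on `K` subordinate to `U` is approximated by `φ ∘ ψ`. At each point at most
`m` blocks are active, all of size one, so some block must contribute more than `δ` over every point
of `K`; the sets where a block does so form the refinement. -/
theorem DecompositionRankLT.exists_shrinking {X : Type*} [TopologicalSpace X] [T2Space X]
    [LocallyCompactSpace X] {m : ℕ} (h : DecompositionRankLT C₀(X, ℂ) m) {K : Set X}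
    (hK : IsCompact K) {k : ℕ} {U : Fin k → Set X} (hU : ∀ i, IsOpen (U i)) (hKU : K ⊆ ⋃ i, U i) :
    ∃ V : Fin k → Set X, (∀ i, IsOpen (V i)) ∧ (∀ i, V i ⊆ U i) ∧ K ⊆ ⋃ i, V i ∧
      FamilyOrderLT V m := by
  classical
  -- A point of `K` guarantees `k > 0`, needed below to choose a maximising index `L i`.
  rcases K.eq_empty_or_nonempty with rfl | ⟨x₀, hx₀⟩
  · refine ⟨fun _ => ∅, fun _ => isOpen_empty, fun _ => empty_subset _, empty_subset _, ?_⟩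
    refine familyOrderLT_iff.2 fun x s hs => ?_
    obtain ⟨i, hi⟩ : s.Nonempty := Finset.card_pos.1 (by omega)
    exact ⟨i, hi, notMem_empty x⟩
  obtain ⟨l₀, -⟩ := mem_iUnion.1 (hKU hx₀)
  obtain ⟨f, hfU, hf1, hf01, hfc⟩ := exists_continuous_sum_one_of_isOpen_isCompact hU hK hKU
  let H : Fin k → C₀(X, ℂ) := fun l =>
    ⟨⟨fun x => ((f l x : ℝ) : ℂ), Complex.continuous_ofReal.comp (f l).continuous⟩, by
      have hc : HasCompactSupport fun x => ((f l x : ℝ) : ℂ) :=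
        (hfc l).comp_left (g := fun t : ℝ => (t : ℂ)) Complex.ofReal_zero
      exact hc.is_zero_at_infty⟩
  have hH : ∀ l x, H l x = ((f l x : ℝ) : ℂ) := fun l x => rfl
  have hH0 : ∀ l, 0 ≤ H l := fun l x => by
    change (0 : ℂ) ≤ ((f l x : ℝ) : ℂ)
    exact_mod_cast (hf01 l x).1
  -- If no block contributes more than `δ` at a point of `K`, each of the `k` functions is at most
  -- `m * δ`, plus the error `δ`, there; their sum must then fall short of 1.
  obtain ⟨δ, hδ, hδ1⟩ : ∃ δ : ℝ, 0 < δ ∧ k * (m * δ) + k * δ < 1 := by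
    refine ⟨1 / (2 * (k * (m + 1) + 1)), by positivity, ?_⟩
    have h0 : (0 : ℝ) < 2 * (k * (m + 1) + 1) := by positivity
    have h1 : (k : ℝ) * (m * (1 / (2 * (k * (m + 1) + 1)))) + k * (1 / (2 * (k * (m + 1) + 1))) =
        k * (m + 1) / (2 * (k * (m + 1) + 1)) := by ring
    rw [h1, div_lt_one h0]
    have : (0 : ℝ) ≤ k * (m + 1) := by positivity
    linarith
  obtain ⟨s, r, ψ, φ, -, -, -, happ, c, hc⟩ := h (Finset.univ.image H) δ hδ
  have hY : ∀ l i, 0 ≤ ψ (H l) i := fun l i => (map_nonneg ψ (hH0 l) : 0 ≤ ψ (H l)) i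
  let B : Fin s → X → ℝ := fun i x => (φ (Pi.single i 1) x).re
  have hone : ∀ i, (0 : CStarMatrix (Fin (r i)) (Fin (r i)) ℂ) ≤ 1 := fun i => zero_le_one
  have hB0 : ∀ i x, 0 ≤ B i x := fun i x =>
    (Complex.nonneg_iff.1 (φ.apply_nonneg (MatSum.single_nonneg (hone i)) x)).1
  have hB : ∀ i x, φ (Pi.single i 1) x = B i x := fun i x =>
    Complex.ext rfl (Complex.nonneg_iff.1
      (φ.apply_nonneg (MatSum.single_nonneg (hone i)) x)).2.symm
  -- The trace: on a block of size one it is the scalar by which `ψ (H l) i` multiplies the unit.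
  let w : Fin k → Fin s → ℝ := fun l i => (∑ a, ψ (H l) i a a).re
  let T : Fin k → Fin s → X → ℝ := fun l i x => (φ (Pi.single i (ψ (H l) i)) x).re
  have hT0 : ∀ l i x, 0 ≤ T l i x := fun l i x =>
    (Complex.nonneg_iff.1 (φ.apply_nonneg (MatSum.single_nonneg (hY l i)) x)).1
  have hTsum : ∀ l x, (φ (ψ (H l)) x).re = ∑ i, T l i x := fun l x => by
    rw [φ.apply_eq_sum_single, Complex.re_sum]
  have hTB : ∀ l i x, B i x = 0 → T l i x = 0 := fun l i x hx => by
    have := φ.apply_single_eq_zero (by rw [hB, hx, Complex.ofReal_zero]) (hY l i) (x := x)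
    simp only [T, this, Complex.zero_re]
  have hTw : ∀ l i x, B i x ≠ 0 → T l i x = w l i * B i x := fun l i x hx => by
    have hr : r i ≤ 1 := (hc (c i)).size_le_one (i := i) rfl (x := x) (by
      rw [hB]; exact_mod_cast hx)
    simp only [T]
    rw [CStarMatrix.eq_smul_one_of_le_one hr (ψ (H l) i), Pi.single_smul, map_smul,
      ZeroAtInftyContinuousMap.smul_apply, hB, smul_eq_mul, Complex.re_mul_ofReal]
  have hclose : ∀ l x, |∑ i, T l i x - f l x| < δ := fun l x => by
    have h1 := (φ (ψ (H l)) - H l).norm_apply_le x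
    have h2 := happ (H l) (Finset.mem_image_of_mem _ (Finset.mem_univ _))
    have h3 := Complex.abs_re_le_norm ((φ (ψ (H l)) - H l) x)
    rw [ZeroAtInftyContinuousMap.sub_apply, Complex.sub_re, hTsum, hH, Complex.ofReal_re] at h3
    rw [ZeroAtInftyContinuousMap.sub_apply, hH] at h1
    linarith
  have hcol : ∀ i j x, B i x ≠ 0 → B j x ≠ 0 → c i = c j → i = j := by
    intro i j x hi hj hij
    by_contra hne
    have := (hc (c j)).apply_single_one_mul_eq_zero (i := i) (j := j) hij rfl hne x
    rw [hB, hB] at this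
    exact mul_ne_zero hi hj (by exact_mod_cast this)
  have hL : ∀ i, ∃ l, ∀ l', w l' i ≤ w l i := fun i => by
    obtain ⟨l, -, hl⟩ := Finset.exists_max_image Finset.univ (fun l => w l i) ⟨l₀, Finset.mem_univ _⟩
    exact ⟨l, fun l' => hl l' (Finset.mem_univ _)⟩
  choose L hL using hL
  -- On `V i` block `i` alone contributes more than the error `δ` to the approximant of `f (L i)`,
  -- so `f (L i)` is positive there. Maximality of `L i` bounds every contribution of the block by
  -- `δ` off `V i`.
  let V : Fin s → Set X := fun i => {x | δ < w (L i) i * B i x}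
  have hVB : ∀ i x, x ∈ V i → B i x ≠ 0 := fun i x (hx : δ < w (L i) i * B i x) h0 => by
    rw [h0, mul_zero] at hx
    linarith
  have hVo : ∀ i, IsOpen (V i) := fun i => isOpen_lt continuous_const
    (continuous_const.mul (Complex.continuous_re.comp (φ (Pi.single i 1)).continuous))
  have hVU : ∀ i, V i ⊆ U (L i) := fun i x hx => by
    have h1 : δ < w (L i) i * B i x := hx
    rw [← hTw _ _ _ (hVB i x hx)] at h1
    have h2 := Finset.single_le_sum (f := fun j => T (L i) j x) (fun j _ => hT0 _ j x)
      (Finset.mem_univ i)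
    have h3 := (abs_lt.1 (hclose (L i) x)).2
    have h4 : f (L i) x ≠ 0 := by
      linarith
    exact hfU _ (subset_tsupport _ h4)
  have hVK : ∀ x ∈ K, ∃ i, x ∈ V i := by
    intro x hx
    by_contra! hxV
    have hTδ : ∀ l i, T l i x ≤ δ := fun l i => by
      by_cases h0 : B i x = 0
      · rw [hTB l i x h0]
        exact hδ.le
      · rw [hTw l i x h0]
        exact (mul_le_mul_of_nonneg_right (hL i l) (hB0 i x)).trans (not_lt.1 (hxV i))
    have hcard : (Finset.univ.filter fun i => B i x ≠ 0).card ≤ m := by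
      rw [← Fintype.card_fin m]
      exact Finset.card_le_card_of_injOn c (fun _ _ => Finset.mem_univ _) fun i hi j hj hij =>
        hcol i j x (by simpa using hi) (by simpa using hj) hij
    have hsum : ∀ l, ∑ i, T l i x ≤ m * δ := fun l => by
      rw [← Finset.sum_filter_of_ne (p := fun i => B i x ≠ 0)
        fun i _ hi h0 => hi (hTB l i x h0)]
      calc _ ≤ (Finset.univ.filter fun i => B i x ≠ 0).card • δ :=
            Finset.sum_le_card_nsmul _ _ _ fun i _ => hTδ l i
        _ ≤ m * δ := by
            rw [nsmul_eq_mul]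
            exact mul_le_mul_of_nonneg_right (by exact_mod_cast hcard) hδ.le
    have h1 : ∑ l, f l x = 1 := by simpa using hf1 hx
    have h2 : ∑ l, f l x ≤ ∑ _l : Fin k, (m * δ + δ) := Finset.sum_le_sum fun l _ => by
      linarith [(abs_lt.1 (hclose l x)).1, hsum l]
    rw [h1, Finset.sum_const, Finset.card_univ, Fintype.card_fin, nsmul_eq_mul, mul_add] at h2
    linarith
  have hVord : FamilyOrderLT V m := by
    refine familyOrderLT_iff.2 fun x t ht => ?_
    by_contra! hx
    have hle : t.card ≤ Fintype.card (Fin m) :=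
      Finset.card_le_card_of_injOn c (fun _ _ => Finset.mem_univ _) fun i hi j hj hij =>
        hcol i j x (hVB i x (hx i hi)) (hVB j x (hx j hj)) hij
    rw [Fintype.card_fin] at hle
    omega
  refine ⟨fun l => ⋃ (i : Fin s) (_ : L i = l), V i,
    fun l => isOpen_iUnion fun i => isOpen_iUnion fun _ => hVo i, fun l => ?_, fun x hx => ?_,
    hVord.iUnion_fiber L⟩
  · refine iUnion₂_subset fun i hi => ?_
    rw [← hi]
    exact hVU i
  · obtain ⟨i, hi⟩ := hVK x hx
    exact mem_iUnion.2 ⟨L i, mem_iUnion₂.2 ⟨i, rfl, hi⟩⟩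

theorem DecompositionRankLT.coveringDimLT {X : Type u} [TopologicalSpace X] [T2Space X]
    [LocallyCompactSpace X] [SigmaCompactSpace X] {m : ℕ} (h : DecompositionRankLT C₀(X, ℂ) m) :
    CoveringDimLT X m :=
  coveringDimLT_of_isCompact fun K hK k U hU hKU => by
    obtain ⟨V, hV, hVU, hKV, hord⟩ := h.exists_shrinking hK hU hKU
    exact ⟨V, hV, hVU, hKV, fun x _ => familyOrderLT_iff.1 hord x⟩

end DimensionOfSpectrum

theorem proposition3p4 (X : Type u) [TopologicalSpace X] [T2Space X] [LocallyCompactSpace X]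
    [SecondCountableTopology X] :
    decompositionRank C₀(X, ℂ) = coveringDim X := by
  have : DecompositionRankLT C₀(X, ℂ) = CoveringDimLT X := funext fun m =>
    propext ⟨fun h => h.coveringDimLT, fun h => h.decompositionRankLT⟩
  rw [decompositionRank, coveringDim, this]
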